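/- Let $k\ge 1$, let $\underline{X}$ (nonempty) and $\underline{Y}$ be compact metric spaces of finite covering dimension, and let $f:\underline{X}\to\underline{Y}$ be a continuous map. Let $\mathbb{Z}^k$ act on $\underline{X}^{\mathbb{Z}^k}$ by the shift $\gamma.(x_a)_{a\in\mathbb{Z}^k}=(x_{\gamma+a})_{a\in\mathbb{Z}^k}$, and put $$d(x,y)=\sum_{a\in\mathbb{Z}^k}2^{-|a|}\,d(x_a,y_a),\qquad |a|=|a_1|+\cdots+|a_k| .$$ Let $F:\underline{X}^{\mathbb{Z}^k}\to\underline{Y}^{\mathbb{Z}^k}$, $F((x_a)_a)=(f(x_a))_a$, let $\Delta\subset\underline{Y}^{\mathbb{Z}^k}$ be the diagonal (the set of constant families), and let $Z=F^{-1}(\Delta)$, a shift-invariant subset of $\underline{X}^{\mathbb{Z}^k}$. Then $$\dim(Z:\mathbb{Z}^k)\le\sup_{y\in\underline{Y}}\dim f^{-1}(y).$$ Here $\dim f^{-1}(y)$ is the covering dimension ($-1$ for the empty set), and $\dim(Z:\mathbb{Z}^k)$ is the mean dimension, defined as follows. For a compact space $Z$ with a distance function $\rho$ and $\varepsilon>0$,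 $\mathrm{Widim}_\varepsilon(Z,\rho)$ is the least $n$ such that there are a finite polyhedron $P$ of dimension $n$ and a continuous map $g:Z\to P$ all of whose fibres have $\rho$-diameter at most $\varepsilon$. With $I_n=[0,n)^k\cap\mathbb{Z}^k$ and $d_{I_n}(x,y)=\max_{\gamma\in I_n}d(\gamma.x,\gamma.y)$, $$\dim(Z:\mathbb{Z}^k)=\lim_{\varepsilon\downarrow 0}\,\limsup_{n\to\infty}\frac{1}{n^k}\,\mathrm{Widim}_\varepsilon(Z,d_{I_n}),$$ where the $\limsup$ over $n$ is in fact a limit. -/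

import Mathlib

namespace MeanDim

open Filter Topology

universe u v

/-- `X` has covering dimension at most `n`: every finite open cover of `X` has a finite open
refinement such that every point lies in at most `n + 1` of its members. -/
def CoveringDimLE (X : Type u) [TopologicalSpace X] (n : ℕ) : Prop :=
  ∀ U : Set (Set X), U.Finite → (∀ u ∈ U, IsOpen u) → ⋃₀ U = Set.univ →
    ∃ V : Set (Set X), V.Finite ∧ (∀ v ∈ V, IsOpen v) ∧ ⋃₀ V = Set.univ ∧
      (∀ v ∈ V, ∃ u ∈ U, v ⊆ u) ∧ ∀ x : X, {v ∈ V | x ∈ v}.encard ≤ n + 1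

open Classical in
/-- The covering dimension, with value in `{-1, 0, 1, 2, …, ∞}`; it is `-1` exactly for the
empty space. -/
noncomputable def coveringDim (X : Type u) [TopologicalSpace X] : EReal :=
  if IsEmpty X then -1 else ⨅ (n : ℕ) (_ : CoveringDimLE X n), (n : EReal)

/-- A continuous map `f : X → P` is an `ε`-embedding with respect to the distance function `d`
if every fibre of `f` has `d`-diameter at most `ε`. -/
def IsEpsEmbedding {X : Type u} {P : Type v} [TopologicalSpace X] [TopologicalSpace P]
    (d : X → X → ℝ) (ε : ℝ) (f : X → P) : Prop :=
  Continuous f ∧ ∀ p : P, ∀ x ∈ f ⁻¹' {p}, ∀ x' ∈ f ⁻¹' {p}, d x x' ≤ ε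

/-- `Widim_ε (X, d)`: the least `n` such that `X` has an `ε`-embedding into a finite polyhedron of
dimension (at most) `n`. A finite polyhedron is the underlying space of a finite geometric
simplicial complex in some `ℝ^m`; its dimension is at most `n` if every simplex has at most
`n + 1` vertices. -/
noncomputable def widim (X : Type u) [TopologicalSpace X] (d : X → X → ℝ) (ε : ℝ) : EReal :=
  ⨅ (n : ℕ) (_ : ∃ (m : ℕ) (K : Geometry.SimplicialComplex ℝ (EuclideanSpace ℝ (Fin m)))
      (f : X → K.space), K.faces.Finite ∧ (∀ s ∈ K.faces, s.card ≤ n + 1) ∧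
        IsEpsEmbedding d ε f), (n : EReal)

/-- The distance `d_Ω (x, y) = max_{γ ∈ Ω} d (γ.x, γ.y)`, for a finite set `Ω ⊆ ℤ^k`. -/
noncomputable def orbitDist {k : ℕ} {X : Type u} [AddAction (Fin k → ℤ) X] (d : X → X → ℝ)
    (Ω : Finset (Fin k → ℤ)) (x y : X) : ℝ :=
  ⨆ γ : Ω, d ((γ : Fin k → ℤ) +ᵥ x) ((γ : Fin k → ℤ) +ᵥ y)

/-- The cube `I_n = [0, n)^k ∩ ℤ^k`. -/
noncomputable def cube (k n : ℕ) : Finset (Fin k → ℤ) :=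
  Fintype.piFinset fun _ => Finset.Ico (0 : ℤ) n

/-- `Widim_ε (X : ℤ^k) = lim_{n → ∞} n^{-k} Widim_ε (X, d_{I_n})`. For an action of `ℤ^k` by
homeomorphisms on a compact metric space this limit exists; it is written as a `limsup`, which is
defined without reference to that fact and agrees with the limit. -/
noncomputable def widimRate (k : ℕ) (X : Type u) [TopologicalSpace X] [AddAction (Fin k → ℤ) X]
    (d : X → X → ℝ) (ε : ℝ) : EReal :=
  limsup (fun n : ℕ => widim X (orbitDist d (cube k n)) ε / (n : EReal) ^ k) atTop

/-- The mean dimension `dim (X : ℤ^k) = lim_{ε ↓ 0} Widim_ε (X : ℤ^k)`. The quantity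
`Widim_ε (X : ℤ^k)` does not decrease as `ε` decreases, so the limit is the supremum. -/
noncomputable def meanDim (k : ℕ) (X : Type u) [TopologicalSpace X] [AddAction (Fin k → ℤ) X]
    (d : X → X → ℝ) : EReal :=
  ⨆ (ε : ℝ) (_ : 0 < ε), widimRate k X d ε

/-- The distance `d (x, y) = ∑_{a ∈ ℤ^k} 2^{-|a|} d (x_a, y_a)` on `A^{ℤ^k}`, where
`|a| = |a_1| + ⋯ + |a_k|`; the series converges for compact `A`, see `summable_seqDist`. -/
noncomputable def seqDist {k : ℕ} {A : Type u} [MetricSpace A] (x y : (Fin k → ℤ) → A) : ℝ :=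
  ∑' a : Fin k → ℤ, (2 : ℝ) ^ (-∑ i, |a i|) * dist (x a) (y a)

theorem summable_w (k : ℕ) : Summable fun a : Fin k → ℤ => (2 : ℝ) ^ (-∑ i, |a i|) := by
  induction k with
  | zero => exact Summable.of_finite
  | succ k ih =>
    have h1 : Summable fun n : ℤ => (2 : ℝ) ^ (-|n|) := by
      have : Summable fun n : ℕ => (2 : ℝ) ^ (-|(n : ℤ)|) := by
        simpa using summable_geometric_two
      refine Summable.of_nat_of_neg this (by simpa)
    rw [← (Fin.consEquiv fun _ => ℤ).summable_iff]
    refine (h1.mul_of_nonneg ih (fun _ => by positivity) (fun _ => by positivity)).congr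
      fun p => ?_
    simp only [Function.comp, Fin.consEquiv, Equiv.coe_fn_mk, Fin.sum_univ_succ, Fin.cons_zero,
      Fin.cons_succ, neg_add]
    rw [zpow_add₀ (by norm_num)]

theorem summable_seqDist {k : ℕ} {A : Type u} [MetricSpace A] [CompactSpace A]
    (x y : (Fin k → ℤ) → A) :
    Summable fun a : Fin k → ℤ => (2 : ℝ) ^ (-∑ i, |a i|) * dist (x a) (y a) := by
  refine Summable.of_nonneg_of_le (fun _ => by positivity) (fun a => ?_)
    ((summable_w k).mul_right (Metric.diam (Set.univ : Set A)))
  gcongr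
  exact Metric.dist_le_diam_of_mem isCompact_univ.isBounded trivial trivial

/-- The coordinatewise map `F : A^{ℤ^k} → B^{ℤ^k}` induced by `f : A → B`. -/
def coordMap (k : ℕ) {A : Type u} {B : Type v} (f : A → B) (x : (Fin k → ℤ) → A) :
    (Fin k → ℤ) → B :=
  fun a => f (x a)

/-- The diagonal of `B^{ℤ^k}`: the constant families. -/
def diagonal (k : ℕ) (B : Type v) : Set ((Fin k → ℤ) → B) :=
  Set.range fun (b : B) (_ : Fin k → ℤ) => b

/-- The subshift `Z = F⁻¹(Δ)` of `A^{ℤ^k}`. -/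
def diagSubshift (k : ℕ) {A : Type u} {B : Type v} (f : A → B) : Set ((Fin k → ℤ) → A) :=
  coordMap k f ⁻¹' diagonal k B

/-- The shift action of `ℤ^k` on `Z`, `(γ.x)_a = x_{γ + a}`. -/
instance diagSubshiftAction (k : ℕ) {A : Type u} {B : Type v} (f : A → B) :
    AddAction (Fin k → ℤ) (diagSubshift k f) where
  vadd γ x := ⟨fun a => x.1 (γ + a), by
    obtain ⟨b, hb⟩ := x.2
    exact ⟨b, funext fun a => congrFun hb (γ + a)⟩⟩
  zero_vadd x := Subtype.ext (funext fun a => congrArg x.1 (zero_add a))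
  add_vadd γ γ' x := Subtype.ext (funext fun a => congrArg x.1 (by
    rw [add_comm γ γ', add_assoc]))

end MeanDim

namespace MeanDim

open Filter Topology MeasureTheory

universe u v

/-! A point of `Z` has all its coordinates in one fibre of `f`, and at scale ε the distance over
`I_N` depends only on the coordinates in a cube `S` with about N^k points. So it suffices to map the
fibre power of `f` over `S`, with small fibres, to a polyhedron of dimension n|S| + C, where n
bounds the fibre dimensions and C does not depend on `S`.

Near each fibre there is a fine open cover of order n + 1 (`exists_cover_near_fibre`); finitely many
of these, over open sets W_1, …, W_m, serve all of B. Over the overlaps of the W_i the orders add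
up, so using one map for every factor would multiply this excess by |S|. Instead each factor gets
its own shrinking of (W_i), chosen so that every y lies in an overlap for at most m factors
(`exists_nearly_disjoint_shrinkings`). The total excess is then bounded, and dividing by N^k leaves
n.

The targets are skeleta of cubes rather than nerves: dimension becomes the number of coordinates
strictly between 0 and 1, which is additive over the factors (`widim_le_of_cube_map`). -/

/-! ### Skeleta of a cube as simplicial complexes -/

/-- The nonempty chains of `0`-`1`-vectors any two of which differ in at most `n` coordinates: the
simplices of the Kuhn triangulation of the `n`-skeleton of the cube `[0, 1]^m`. -/
def IsKuhnFace {m : ℕ} (n : ℕ) (s : Finset (EuclideanSpace ℝ (Fin m))) : Prop :=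
  s.Nonempty ∧ (∀ v ∈ s, ∀ j, v j = 0 ∨ v j = 1) ∧
    (∀ v ∈ s, ∀ w ∈ s, (∀ j, v j ≤ w j) ∨ ∀ j, w j ≤ v j) ∧
    ∀ v ∈ s, ∀ w ∈ s, (Finset.univ.filter fun j => v j ≠ w j).card ≤ n

theorem exists_forall_le_of_chain {m : ℕ} {s : Finset (EuclideanSpace ℝ (Fin m))}
    (hs : s.Nonempty) (hc : ∀ v ∈ s, ∀ w ∈ s, (∀ j, v j ≤ w j) ∨ ∀ j, w j ≤ v j) :
    ∃ v ∈ s, ∀ w ∈ s, ∀ j, v j ≤ w j := by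
  obtain ⟨v, hv, hmin⟩ := s.exists_min_image (fun v => ∑ j, v j) hs
  refine ⟨v, hv, fun w hw => ?_⟩
  rcases hc v hv w hw with h | h
  · exact h
  · have h1 : ∑ j, w j = ∑ j, v j := le_antisymm (Finset.sum_le_sum fun j _ => h j) (hmin w hw)
    intro j
    exact ((Finset.sum_eq_sum_iff_of_le fun j _ => h j).1 h1 j (Finset.mem_univ j)).ge

theorem exists_forall_ge_of_chain {m : ℕ} {s : Finset (EuclideanSpace ℝ (Fin m))}
    (hs : s.Nonempty) (hc : ∀ v ∈ s, ∀ w ∈ s, (∀ j, v j ≤ w j) ∨ ∀ j, w j ≤ v j) :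
    ∃ v ∈ s, ∀ w ∈ s, ∀ j, w j ≤ v j := by
  obtain ⟨v, hv, hmax⟩ := s.exists_max_image (fun v => ∑ j, v j) hs
  refine ⟨v, hv, fun w hw => ?_⟩
  rcases hc v hv w hw with h | h
  · have h1 : ∑ j, v j = ∑ j, w j := le_antisymm (Finset.sum_le_sum fun j _ => h j) (hmax w hw)
    intro j
    exact ((Finset.sum_eq_sum_iff_of_le fun j _ => h j).1 h1 j (Finset.mem_univ j)).ge
  · exact h

theorem finite_zero_one_vectors (m : ℕ) :
    {v : EuclideanSpace ℝ (Fin m) | ∀ j, v j = 0 ∨ v j = 1}.Finite := by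
  have h : (Set.univ.pi fun _ : Fin m => ({0, 1} : Set ℝ)).Finite :=
    Set.Finite.pi fun _ => Set.toFinite _
  refine (h.image (WithLp.toLp 2)).subset fun v hv => ⟨WithLp.ofLp v, fun j _ => ?_, rfl⟩
  simpa using hv j

namespace IsKuhnFace

variable {m n : ℕ} {s : Finset (EuclideanSpace ℝ (Fin m))}

theorem mono {t : Finset (EuclideanSpace ℝ (Fin m))} (hs : IsKuhnFace n s) (hts : t ⊆ s)
    (ht : t.Nonempty) : IsKuhnFace n t :=
  ⟨ht, fun v hv => hs.2.1 v (hts hv), fun v hv w hw => hs.2.2.1 v (hts hv) w (hts hw),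
    fun v hv w hw => hs.2.2.2 v (hts hv) w (hts hw)⟩

/-- Along the chain, the number of coordinates in which a vertex differs from the least one is
strictly increasing and at most n. -/
theorem card_le (hs : IsKuhnFace n s) : s.card ≤ n + 1 := by
  obtain ⟨hne, h01, hc, hn⟩ := hs
  obtain ⟨b, hb, hbot⟩ := exists_forall_le_of_chain hne hc
  have aux : ∀ v ∈ s, ∀ w ∈ s, (∀ j, v j ≤ w j) →
      (Finset.univ.filter fun j => v j ≠ b j).card =
        (Finset.univ.filter fun j => w j ≠ b j).card → v = w := by
    intro v hv w hw hvw hcard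
    have hsub : (Finset.univ.filter fun j => v j ≠ b j) ⊆
        Finset.univ.filter fun j => w j ≠ b j := by
      intro j hj
      simp only [Finset.mem_filter, Finset.mem_univ, true_and] at hj ⊢
      exact ((lt_of_le_of_ne (hbot v hv j) (Ne.symm hj)).trans_le (hvw j)).ne'
    have heq := Finset.eq_of_subset_of_card_le hsub hcard.ge
    ext j
    by_contra hne'
    have hlt := lt_of_le_of_ne (hvw j) hne'
    have hw1 : w j = 1 := by
      rcases h01 w hw j with h | h
      · rcases h01 v hv j with h' | h' <;> linarith
      · exact h
    have hv0 : v j = 0 := by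
      rcases h01 v hv j with h | h
      · exact h
      · linarith
    have hb0 : b j = 0 := by
      rcases h01 b hb j with h | h
      · exact h
      · linarith [hbot v hv j]
    have : j ∈ Finset.univ.filter fun j => v j ≠ b j := by
      rw [heq]
      simp [hw1, hb0]
    simp [hv0, hb0] at this
  have := Finset.card_le_card_of_injOn
    (fun v : EuclideanSpace ℝ (Fin m) => (Finset.univ.filter fun j => v j ≠ b j).card)
    (s := s) (t := Finset.range (n + 1))
    (fun v hv => by simpa [Nat.lt_succ_iff] using hn v hv b hb)
    (fun v hv w hw hvw => (hc v hv w hw).elim (fun h => aux v hv w hw h hvw)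
      fun h => (aux w hw v hv h hvw.symm).symm)
  simpa using this

/-- In a vanishing combination take the two highest vertices of nonzero weight. A coordinate where
they differ is 1 at the top vertex and 0 at all lower ones, so it isolates the top weight. -/
theorem affineIndependent (hs : IsKuhnFace n s) :
    AffineIndependent ℝ ((↑) : s → EuclideanSpace ℝ (Fin m)) := by
  classical
  obtain ⟨-, h01, hc, -⟩ := hs
  rw [affineIndependent_iff]
  intro u w hw0 hwv e₀ he₀
  by_contra hne
  have hcoord : ∀ j, ∑ e ∈ u, w e * e.1 j = 0 := fun j => by
    simpa using congrArg (fun v : EuclideanSpace ℝ (Fin m) => v j) hwv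
  set T : Finset (EuclideanSpace ℝ (Fin m)) := (u.filter fun e => w e ≠ 0).image (↑) with hT
  have hTs : ∀ v ∈ T, v ∈ s := by
    intro v hv
    obtain ⟨e, -, rfl⟩ := Finset.mem_image.1 hv
    exact e.2
  have hTmem : ∀ e ∈ u, w e ≠ 0 → e.1 ∈ T := fun e he hwe =>
    Finset.mem_image.2 ⟨e, Finset.mem_filter.2 ⟨he, hwe⟩, rfl⟩
  obtain ⟨v, hv, hvtop⟩ := exists_forall_ge_of_chain ⟨_, hTmem e₀ he₀ hne⟩
    fun a ha b hb => hc a (hTs a ha) b (hTs b hb)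
  obtain ⟨e, he, rfl⟩ := Finset.mem_image.1 hv
  obtain ⟨heu, hwe⟩ := Finset.mem_filter.1 he
  by_cases hT' : (T.erase e.1).Nonempty
  · obtain ⟨v', hv', hv'top⟩ := exists_forall_ge_of_chain hT' fun a ha b hb =>
      hc a (hTs a (Finset.mem_of_mem_erase ha)) b (hTs b (Finset.mem_of_mem_erase hb))
    have hv's := hTs v' (Finset.mem_of_mem_erase hv')
    obtain ⟨j, hj⟩ : ∃ j, v' j ≠ e.1 j := by
      by_contra! h
      exact Finset.ne_of_mem_erase hv' (by ext j; exact h j)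
    have hlt := lt_of_le_of_ne (hvtop v' (Finset.mem_of_mem_erase hv') j) hj
    have he1 : e.1 j = 1 := by
      rcases h01 e.1 e.2 j with h | h
      · rcases h01 v' hv's j with h' | h' <;> linarith
      · exact h
    have hv0 : v' j = 0 := by
      rcases h01 v' hv's j with h | h
      · exact h
      · linarith
    have hsum := hcoord j
    rw [Finset.sum_eq_single e] at hsum
    · exact hwe (by simpa [he1] using hsum)
    · intro d hd hde
      by_cases hwd : w d = 0
      · simp [hwd]
      have h1 := hv'top d.1 (Finset.mem_erase.2 ⟨fun h => hde (Subtype.ext h), hTmem d hd hwd⟩) j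
      have h2 : d.1 j = 0 := by
        rcases h01 d.1 d.2 j with h | h
        · exact h
        · linarith
      simp [h2]
    · exact fun h => absurd heu h
  · rw [Finset.sum_eq_single e] at hw0
    · exact hwe hw0
    · intro d hd hde
      by_contra hwd
      exact hT' ⟨d.1, Finset.mem_erase.2 ⟨fun h => hde (Subtype.ext h), hTmem d hd hwd⟩⟩
    · exact fun h => absurd heu h

end IsKuhnFace

/-- The indicator vector of the superlevel set `{j | t ≤ x j}`. -/
noncomputable def levelVec {m : ℕ} (x : EuclideanSpace ℝ (Fin m)) (t : ℝ) :
    EuclideanSpace ℝ (Fin m) :=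
  WithLp.toLp 2 fun j => if t ≤ x j then 1 else 0

theorem levelVec_apply {m : ℕ} (x : EuclideanSpace ℝ (Fin m)) (t : ℝ) (j : Fin m) :
    levelVec x t j = if t ≤ x j then 1 else 0 := rfl

/-- The coordinate x_j is the total weight of the vertices v with v_j = 1, an upper segment of the
chain. The level vector at t is therefore the highest vertex above which (itself included) the
weight is still at least t. Thus `x` alone determines vertices common to all faces containing it. -/
theorem IsKuhnFace.levelVec_mem {m n : ℕ} {s : Finset (EuclideanSpace ℝ (Fin m))}
    (hs : IsKuhnFace n s) {x : EuclideanSpace ℝ (Fin m)}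
    (hx : x ∈ convexHull ℝ (s : Set (EuclideanSpace ℝ (Fin m)))) {t : ℝ} (ht : t ∈ Set.Ioc 0 1) :
    levelVec x t ∈ s := by
  classical
  obtain ⟨hne, h01, hc, -⟩ := hs
  obtain ⟨w, hw0, hw1, hwx⟩ := Finset.mem_convexHull'.1 hx
  have hxj : ∀ j, x j = ∑ v ∈ s.filter (fun v => v j = 1), w v := fun j => by
    rw [← hwx, Finset.sum_filter, WithLp.ofLp_sum, Finset.sum_apply]
    refine Finset.sum_congr rfl fun v hv => ?_
    rcases h01 v hv j with h | h <;> simp [h]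
  let up : EuclideanSpace ℝ (Fin m) → ℝ := fun v => ∑ u ∈ s.filter (fun u => ∀ j, v j ≤ u j), w u
  obtain ⟨b, hb, hbot⟩ := exists_forall_le_of_chain hne hc
  have hbup : t ≤ up b := by
    have : up b = 1 := by
      rw [← hw1]
      exact congrArg (fun r => Finset.sum r w) (Finset.filter_true_of_mem hbot)
    exact ht.2.trans this.ge
  obtain ⟨v, hv, hvtop⟩ := exists_forall_ge_of_chain (s := s.filter fun v => t ≤ up v)
    ⟨b, Finset.mem_filter.2 ⟨hb, hbup⟩⟩ fun a ha b hb =>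
      hc a (Finset.mem_filter.1 ha).1 b (Finset.mem_filter.1 hb).1
  obtain ⟨hvs, hvup⟩ := Finset.mem_filter.1 hv
  convert hvs
  ext j
  rw [levelVec_apply]
  rcases h01 v hvs j with h | h
  · rw [h, if_neg]
    rw [not_le, hxj]
    by_cases hne' : (s.filter fun u => u j = 1).Nonempty
    · obtain ⟨u, hu, hubot⟩ := exists_forall_le_of_chain hne' fun a ha b hb =>
        hc a (Finset.mem_filter.1 ha).1 b (Finset.mem_filter.1 hb).1
      obtain ⟨hus, huj⟩ := Finset.mem_filter.1 hu
      have h1 : up u < t := by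
        by_contra! hge
        have := hvtop u (Finset.mem_filter.2 ⟨hus, hge⟩) j
        linarith
      refine lt_of_le_of_lt (Finset.sum_le_sum_of_subset_of_nonneg ?_ ?_) h1
      · intro a ha
        exact Finset.mem_filter.2 ⟨(Finset.mem_filter.1 ha).1, hubot a ha⟩
      · exact fun a ha _ => hw0 a (Finset.mem_filter.1 ha).1
    · rw [Finset.not_nonempty_iff_eq_empty.1 hne', Finset.sum_empty]
      exact ht.1
  · rw [h, if_pos]
    rw [hxj]
    refine hvup.trans (Finset.sum_le_sum_of_subset_of_nonneg ?_ ?_)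
    · intro a ha
      obtain ⟨has, hva⟩ := Finset.mem_filter.1 ha
      refine Finset.mem_filter.2 ⟨has, ?_⟩
      rcases h01 a has j with h' | h'
      · linarith [hva j]
      · exact h'
    · exact fun a ha _ => hw0 a (Finset.mem_filter.1 ha).1

theorem finite_levelVec {m : ℕ} (x : EuclideanSpace ℝ (Fin m)) (T : Set ℝ) :
    (levelVec x '' T).Finite := by
  refine (finite_zero_one_vectors m).subset ?_
  rintro _ ⟨t, -, rfl⟩ j
  rw [levelVec_apply]
  split_ifs <;> simp

/-- Layer-cake formula: `x` is the average of its level vectors over t in (0, 1], and the hull of a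
finite set is closed and convex. -/
theorem mem_convexHull_levelVec {m : ℕ} {x : EuclideanSpace ℝ (Fin m)}
    (hx : ∀ j, x j ∈ Set.Icc (0 : ℝ) 1) :
    x ∈ convexHull ℝ (levelVec x '' Set.Ioc 0 1) := by
  let μ : Measure ℝ := volume.restrict (Set.Ioc 0 1)
  have : IsProbabilityMeasure μ := ⟨by simp [μ]⟩
  have hcoord : ∀ j, (fun t => levelVec x t j) = (Set.Iic (x j)).indicator fun _ => (1 : ℝ) := by
    intro j
    funext t
    simp [levelVec_apply, Set.indicator]
  have hint' : ∀ j, Integrable (fun t => levelVec x t j) μ := fun j => by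
    rw [hcoord]
    exact (integrable_const _).indicator measurableSet_Iic
  have hint : Integrable (levelVec x) μ := Integrable.of_eval_piLp hint'
  have hmem := (convex_convexHull ℝ (levelVec x '' Set.Ioc 0 1)).integral_mem (μ := μ)
    ((finite_levelVec x _).isClosed_convexHull ℝ)
    (ae_restrict_of_forall_mem measurableSet_Ioc fun t ht =>
      subset_convexHull ℝ _ (Set.mem_image_of_mem _ ht)) hint
  convert hmem
  ext j
  have h1 : (∫ t, levelVec x t ∂μ) j = ∫ t, levelVec x t j ∂μ :=
    ((EuclideanSpace.proj j : EuclideanSpace ℝ (Fin m) →L[ℝ] ℝ).integral_comp_comm hint).symm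
  rw [h1, hcoord, integral_indicator measurableSet_Iic, Measure.restrict_restrict measurableSet_Iic]
  have h2 : Set.Iic (x j) ∩ Set.Ioc 0 1 = Set.Ioc 0 (x j) := by
    ext t
    simp only [Set.mem_inter_iff, Set.mem_Iic, Set.mem_Ioc]
    exact ⟨fun h => ⟨h.2.1, h.1⟩, fun h => ⟨h.2, h.1, h.2.trans (hx j).2⟩⟩
  rw [h2]
  simp [(hx j).1]

/-- The Kuhn triangulation of the `n`-skeleton of the cube `[0, 1]^m`. -/
noncomputable def cubeSkeleton (m n : ℕ) :
    Geometry.SimplicialComplex ℝ (EuclideanSpace ℝ (Fin m)) where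
  faces := {s | IsKuhnFace n s}
  isRelLowerSet_faces := fun _ hs => ⟨hs.1, fun _ hts ht => IsKuhnFace.mono hs hts ht⟩
  indep := fun hs => IsKuhnFace.affineIndependent hs
  inter_subset_convexHull := by
    rintro s t hs ht x ⟨hxs, hxt⟩
    have hx : ∀ j, x j ∈ Set.Icc (0 : ℝ) 1 := by
      have hconv : Convex ℝ {y : EuclideanSpace ℝ (Fin m) | ∀ j, y j ∈ Set.Icc (0 : ℝ) 1} := by
        intro y hy z hz a b ha hb hab j
        exact convex_Icc (0 : ℝ) 1 (hy j) (hz j) ha hb hab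
      refine convexHull_min (fun v hv j => ?_) hconv hxs
      rcases hs.2.1 v hv j with h | h <;> simp [h]
    -- The level vectors of `x` are vertices of both faces, and their hull contains `x`.
    refine convexHull_mono ?_ (mem_convexHull_levelVec hx)
    rintro _ ⟨r, hr, rfl⟩
    exact ⟨hs.levelVec_mem hxs hr, ht.levelVec_mem hxt hr⟩

/-- The level vectors form a chain, and two of them can differ only in a coordinate lying strictly
between 0 and 1. -/
theorem mem_cubeSkeleton_space {m n : ℕ} {x : EuclideanSpace ℝ (Fin m)}
    (hx : ∀ j, x j ∈ Set.Icc (0 : ℝ) 1)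
    (hn : (Finset.univ.filter fun j => x j ∈ Set.Ioo (0 : ℝ) 1).card ≤ n) :
    x ∈ (cubeSkeleton m n).space := by
  refine Geometry.SimplicialComplex.mem_space_iff.2
    ⟨(finite_levelVec x (Set.Ioc 0 1)).toFinset, ⟨?_, ?_, ?_, ?_⟩, ?_⟩
  · exact ⟨levelVec x 1, by simpa using ⟨1, ⟨one_pos, le_rfl⟩, rfl⟩⟩
  · intro v hv j
    obtain ⟨t, -, rfl⟩ := (Set.Finite.mem_toFinset _).1 hv
    rw [levelVec_apply]
    split_ifs <;> simp
  · have aux : ∀ t t' : ℝ, t ≤ t' → ∀ j, levelVec x t' j ≤ levelVec x t j := by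
      intro t t' h j
      rw [levelVec_apply, levelVec_apply]
      split_ifs with h1 h2
      · exact le_rfl
      · exact absurd (h.trans h1) h2
      · exact zero_le_one
      · exact le_rfl
    intro v hv w hw
    obtain ⟨t, -, rfl⟩ := (Set.Finite.mem_toFinset _).1 hv
    obtain ⟨t', -, rfl⟩ := (Set.Finite.mem_toFinset _).1 hw
    exact (le_total t t').symm.imp (aux t' t) (aux t t')
  · intro v hv w hw
    obtain ⟨t, ht, rfl⟩ := (Set.Finite.mem_toFinset _).1 hv
    obtain ⟨t', ht', rfl⟩ := (Set.Finite.mem_toFinset _).1 hw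
    refine (Finset.card_le_card fun j hj => ?_).trans hn
    rw [Finset.mem_filter] at hj ⊢
    have hj' := hj.2
    rw [levelVec_apply, levelVec_apply] at hj'
    refine ⟨Finset.mem_univ j, ?_⟩
    split_ifs at hj' with h1 h2 h2
    · exact absurd rfl hj'
    · exact ⟨ht.1.trans_le h1, (not_le.1 h2).trans_le ht'.2⟩
    · exact ⟨ht'.1.trans_le h2, (not_le.1 h1).trans_le ht.2⟩
    · exact absurd rfl hj'
  · simpa using mem_convexHull_levelVec hx

theorem widim_le_of_cube_map {X : Type*} [TopologicalSpace X] {d : X → X → ℝ} {ε : ℝ}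
    {J : Type*} [Fintype J] (n : ℕ) (g : X → J → ℝ) (hg : ∀ j, Continuous fun x => g x j)
    (h01 : ∀ x j, g x j ∈ Set.Icc (0 : ℝ) 1)
    (hn : ∀ x, {j | g x j ∈ Set.Ioo (0 : ℝ) 1}.ncard ≤ n)
    (hd : ∀ x x', g x = g x' → d x x' ≤ ε) : widim X d ε ≤ (n : EReal) := by
  let e := Fintype.equivFin J
  have hmem : ∀ x, WithLp.toLp 2 (fun i => g x (e.symm i)) ∈
      (cubeSkeleton (Fintype.card J) n).space := fun x => by
    refine mem_cubeSkeleton_space (fun i => h01 x _) (le_trans (le_of_eq ?_) (hn x))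
    rw [← Set.ncard_coe_finset, ← Set.ncard_image_of_injective _ e.symm.injective]
    congr 1
    ext j
    simp
  refine iInf₂_le n ⟨Fintype.card J, cubeSkeleton _ n, fun x => ⟨_, hmem x⟩, ?_, ?_, ?_, ?_⟩
  · refine (finite_zero_one_vectors (Fintype.card J)).toFinset.powerset.finite_toSet.subset ?_
    exact fun s hs => Finset.mem_coe.2 <| Finset.mem_powerset.2 fun v hv =>
      (Set.Finite.mem_toFinset _).2 (hs.2.1 v hv)
  · exact fun s hs => IsKuhnFace.card_le hs
  · refine Continuous.subtype_mk ?_ _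
    exact (PiLp.continuous_toLp 2 _).comp (continuous_pi fun i => hg _)
  · rintro p x rfl x' hx'
    refine hd x x' (funext fun j => ?_)
    have := congrArg (fun v : EuclideanSpace ℝ (Fin (Fintype.card J)) => v (e j))
      (congrArg Subtype.val hx')
    simpa using this.symm

/-! ### Covers near a fibre -/

/-- The open set of points of a metric space that are closer to `v` than to `T \ v`. For sets `v`
which are open in `T` it is an extension of `v` to an open set of the whole space. -/
def openExtension {A : Type u} [PseudoEMetricSpace A] (T v : Set A) : Set A :=
  {x | Metric.infEDist x v < Metric.infEDist x (T \ v)}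

theorem isOpen_openExtension {A : Type u} [PseudoEMetricSpace A] (T v : Set A) :
    IsOpen (openExtension T v) :=
  isOpen_lt Metric.continuous_infEDist Metric.continuous_infEDist

theorem inter_subset_openExtension {A : Type u} [PseudoEMetricSpace A] {T v o : Set A}
    (ho : IsOpen o) (hv : v = T ∩ o) : v ⊆ openExtension T v := by
  intro x hx
  have hxo : x ∈ o := (hv ▸ hx : x ∈ T ∩ o).2
  rw [openExtension, Set.mem_ofPred_eq, Metric.infEDist_zero_of_mem hx, pos_iff_ne_zero]
  intro h0
  obtain ⟨z, hzo, hz⟩ := mem_closure_iff.1 (Metric.mem_closure_iff_infEDist_zero.2 h0) o ho hxo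
  exact hz.2 (hv ▸ ⟨hz.1, hzo⟩)

/-- Extensions of finitely many subsets of `T` meet at a point only if the sets meet in `T`. -/
theorem exists_forall_mem_of_mem_openExtension {A : Type u} [PseudoEMetricSpace A] {T : Set A}
    {S : Set (Set A)} (hS : S.Finite) (hne : S.Nonempty) (hST : ∀ v ∈ S, v ⊆ T) {x : A}
    (hx : ∀ v ∈ S, x ∈ openExtension T v) : ∃ t ∈ T, ∀ v ∈ S, t ∈ v := by
  -- A point of T closer to `x` than every T \ v must lie in every v; the v₀ with T \ v₀ nearest to
  -- `x` supplies one. If T \ v is empty, its distance is ∞.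
  obtain ⟨v₀, hv₀, hmin⟩ := S.exists_min_image (fun v => Metric.infEDist x (T \ v)) hS hne
  obtain ⟨t, ht, hxt⟩ := Metric.infEDist_lt_iff.1 (hx v₀ hv₀)
  refine ⟨t, hST v₀ hv₀ ht, fun v hv => ?_⟩
  by_contra htv
  exact absurd (hxt.trans_le ((hmin v hv).trans
    (Metric.infEDist_le_edist_of_mem ⟨hST v₀ hv₀ ht, htv⟩))) (lt_irrefl _)

/-- A fine cover of the fibre extends to open sets of A without increase of order. The extension
covers a whole tube f⁻¹(W), because f is a closed map. -/
theorem exists_cover_near_fibre {A : Type u} [MetricSpace A] [CompactSpace A] {B : Type v}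
    [TopologicalSpace B] [T2Space B] {f : A → B} (hf : Continuous f) (y : B) {n : ℕ}
    (hy : CoveringDimLE (f ⁻¹' {y}) n) {ε : ℝ} (hε : 0 < ε) :
    ∃ W : Set B, IsOpen W ∧ y ∈ W ∧ ∃ (ι : Type u) (_ : Finite ι) (U : ι → Set A),
      (∀ i, IsOpen (U i)) ∧ f ⁻¹' W ⊆ ⋃ i, U i ∧ (∀ i, ∀ a ∈ U i, ∀ b ∈ U i, dist a b ≤ ε) ∧
      ∀ x, {i | x ∈ U i}.ncard ≤ n + 1 := by
  classical
  set T : Set A := f ⁻¹' {y} with hT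
  obtain ⟨t, ht⟩ := (isCompact_univ (X := A)).elim_finite_subcover
    (fun a : A => Metric.ball a (ε / 2)) (fun _ => Metric.isOpen_ball)
    (fun a _ => Set.mem_iUnion.2 ⟨a, Metric.mem_ball_self (half_pos hε)⟩)
  obtain ⟨V, hVfin, hVo, hVc, hVr, hVn⟩ := hy
    ((fun a => ((↑) : T → A) ⁻¹' Metric.ball a (ε / 2)) '' (t : Set A))
    (t.finite_toSet.image _)
    (by
      rintro _ ⟨a, -, rfl⟩
      exact Metric.isOpen_ball.preimage continuous_subtype_val)
    (by
      refine Set.eq_univ_of_forall fun x => ?_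
      obtain ⟨a, ha, hxa⟩ := Set.mem_iUnion₂.1 (ht (Set.mem_univ (x : A)))
      exact ⟨_, ⟨a, ha, rfl⟩, hxa⟩)
  have hball : ∀ v : V, ∃ a : A, (v : Set T) ⊆ ((↑) : T → A) ⁻¹' Metric.ball a (ε / 2) := by
    intro v
    obtain ⟨_, ⟨a, -, rfl⟩, hva⟩ := hVr v v.2
    exact ⟨a, hva⟩
  choose c hc using hball
  let e : Set T → Set A := fun v => ((↑) : T → A) '' v
  have he : Function.Injective e := Set.image_injective.2 Subtype.val_injective
  let U : V → Set A := fun v => openExtension T (e v) ∩ Metric.ball (c v) (ε / 2)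
  have hUo : ∀ v, IsOpen (U v) := fun v => (isOpen_openExtension _ _).inter Metric.isOpen_ball
  have hVU : ∀ (v : V) (x : T), x ∈ (v : Set T) → (x : A) ∈ U v := by
    intro v x hx
    obtain ⟨o, ho, hov⟩ := isOpen_induced_iff.1 (hVo v v.2)
    refine ⟨inter_subset_openExtension ho ?_ (Set.mem_image_of_mem _ hx), hc v hx⟩
    simp only [e, ← hov, Subtype.image_preimage_coe]
  refine ⟨(f '' (⋃ v, U v)ᶜ)ᶜ, ?_, ?_, V, hVfin, U, hUo, ?_, ?_, ?_⟩
  · exact ((isOpen_iUnion hUo).isClosed_compl.isCompact.image hf).isClosed.isOpen_compl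
  · rintro ⟨x, hx, hxy⟩
    obtain ⟨v, hv, hxv⟩ := (hVc ▸ Set.mem_univ (⟨x, hxy⟩ : T) : (⟨x, hxy⟩ : T) ∈ ⋃₀ V)
    exact hx (Set.mem_iUnion.2 ⟨⟨v, hv⟩, hVU ⟨v, hv⟩ _ hxv⟩)
  · intro x hx
    by_contra hxU
    exact hx ⟨x, hxU, rfl⟩
  · intro v a ha b hb
    have h1 := Metric.mem_ball.1 ha.2
    have h2 := Metric.mem_ball'.1 hb.2
    linarith [dist_triangle a (c v) b]
  · intro x
    have := hVfin.to_subtype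
    rcases Set.eq_empty_or_nonempty {v : V | x ∈ U v} with h | ⟨v₁, hv₁⟩
    · simp [h]
    obtain ⟨z, hzT, hz⟩ := exists_forall_mem_of_mem_openExtension (T := T) (x := x)
      (S := (fun v : V => e v) '' {v : V | x ∈ U v}) (Set.toFinite _) ⟨_, v₁, hv₁, rfl⟩
      (by
        rintro _ ⟨v, -, rfl⟩ _ ⟨a, -, rfl⟩
        exact a.2)
      (by
        rintro _ ⟨v, hv, rfl⟩
        exact hv.1)
    have hle : {v : V | x ∈ U v}.ncard ≤ {v ∈ V | (⟨z, hzT⟩ : T) ∈ v}.ncard := by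
      refine Set.ncard_le_ncard_of_injOn (fun v : V => (v : Set T)) (fun v hv => ?_)
        Subtype.val_injective.injOn (hVfin.subset fun v hv => hv.1)
      obtain ⟨a, ha, haz⟩ := hz _ ⟨v, hv, rfl⟩
      refine ⟨v.2, ?_⟩
      rwa [show (⟨z, hzT⟩ : T) = a from Subtype.ext haz.symm]
    refine hle.trans ?_
    have h3 := hVn ⟨z, hzT⟩
    rw [← (hVfin.subset fun v hv => hv.1 :
      {v ∈ V | (⟨z, hzT⟩ : T) ∈ v}.Finite).cast_ncard_eq] at h3
    exact_mod_cast h3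

/-! ### Nearly disjoint shrinkings of a cover -/

/-- A finite open cover has `N` open shrinkings such that every point lies in at least two members
of only boundedly many of them. -/
theorem exists_nearly_disjoint_shrinkings {B : Type v} [TopologicalSpace B] [NormalSpace B]
    {m : ℕ} (W : Fin m → Set B) (hWo : ∀ i, IsOpen (W i)) (hW : ⋃ i, W i = Set.univ) (N : ℕ) :
    ∃ W' : Fin N → Fin m → Set B, (∀ c i, IsOpen (W' c i)) ∧ (∀ c i, W' c i ⊆ W i) ∧
      (∀ c, ⋃ i, W' c i = Set.univ) ∧
      ∀ y, {c | ∃ i j, i ≠ j ∧ y ∈ W' c i ∧ y ∈ W' c j}.ncard ≤ m := by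
  obtain ⟨p, hp⟩ := PartitionOfUnity.exists_isSubordinate_of_locallyFinite isClosed_univ W hWo
    (locallyFinite_of_finite W) hW.ge
  have hsum : ∀ y, ∑ i, p i y = 1 := fun y => by
    rw [← finsum_eq_sum_of_fintype, p.sum_eq_one (Set.mem_univ y)]
  -- For each y the partial sums cut [0, 1] into m consecutive intervals of lengths p_i(y).
  let s : ℕ → B → ℝ := fun r y => ∑ i with i.val < r, p i y
  have hs : ∀ r, Continuous (s r) := fun r => continuous_finsetSum _ fun i _ => (p i).continuous
  have hsmono : ∀ y, Monotone fun r => s r y := fun y r r' h =>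
    Finset.sum_le_sum_of_subset_of_nonneg
      (Finset.monotone_filter_right _ fun i _ (hi : i.val < r) => hi.trans_le h)
      fun i _ _ => p.nonneg i y
  have hs0 : ∀ y, s 0 y = 0 := fun y => by simp [s]
  have hsm : ∀ y, s m y = 1 := fun y => by simp [s, hsum y]
  have hssucc : ∀ (i : Fin m) y, s (i.val + 1) y = s i.val y + p i y := fun i y => by
    have : (Finset.univ.filter fun j : Fin m => j.val < i.val + 1) =
        insert i (Finset.univ.filter fun j : Fin m => j.val < i.val) := by
      ext j
      simp only [Finset.mem_filter, Finset.mem_univ, true_and, Finset.mem_insert, Fin.ext_iff]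
      omega
    simp only [s]
    rw [this, Finset.sum_insert (by simp), add_comm]
  -- The i-th interval is nondegenerate and meets the window (c/N, (c+1)/N).
  refine ⟨fun c i => {y | 0 < p i y ∧ (c : ℝ) / N < s (i.val + 1) y ∧ s i.val y < ((c : ℝ) + 1) / N},
    fun c i => ?_, fun c i y hy => ?_, fun c => ?_, fun y => ?_⟩
  · exact (isOpen_lt continuous_const (p i).continuous).inter
      ((isOpen_lt continuous_const (hs _)).inter (isOpen_lt (hs _) continuous_const))
  · exact hp i (subset_tsupport _ (Function.mem_support.2 hy.1.ne'))
  · refine Set.eq_univ_of_forall fun y => ?_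
    have hN : (0 : ℝ) < N := by exact_mod_cast c.pos
    have hex : ∃ r, (c : ℝ) / N < s r y := ⟨m, by
      rw [hsm, div_lt_one hN]
      exact_mod_cast c.2⟩
    classical
    -- The interval ending at the first partial sum beyond c/N meets the window.
    obtain ⟨r, hr, hmin⟩ : ∃ r, (c : ℝ) / N < s r y ∧ ∀ r' < r, s r' y ≤ (c : ℝ) / N :=
      ⟨Nat.find hex, Nat.find_spec hex, fun r' h => not_lt.1 (Nat.find_min hex h)⟩
    have hr0 : r ≠ 0 := by
      rintro rfl
      rw [hs0] at hr
      exact absurd hr (not_lt.2 (by positivity))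
    have hrm : r ≤ m := by
      by_contra! h
      have h1 := hmin m h
      rw [hsm, le_div_iff₀ hN] at h1
      have : (c : ℝ) < N := by exact_mod_cast c.2
      linarith
    obtain ⟨q, rfl⟩ := Nat.exists_eq_succ_of_ne_zero hr0
    have h1 := hmin q (Nat.lt_succ_self q)
    have h2 := hssucc ⟨q, hrm⟩ y
    simp only [Nat.succ_eq_add_one] at hr h2
    refine Set.mem_iUnion.2 ⟨⟨q, hrm⟩, ?_, hr, ?_⟩
    · linarith
    · refine h1.trans_lt ?_
      gcongr
      linarith
  -- If two intervals meet one window, a breakpoint lies inside it. The windows are disjoint and at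
  -- most m breakpoints are available.
  · have hkey : ∀ c : Fin N, (∃ i j : Fin m, i ≠ j ∧
        (0 < p i y ∧ (c : ℝ) / N < s (i.val + 1) y ∧ s i.val y < ((c : ℝ) + 1) / N) ∧
        (0 < p j y ∧ (c : ℝ) / N < s (j.val + 1) y ∧ s j.val y < ((c : ℝ) + 1) / N)) →
        ∃ i : Fin m, (c : ℝ) / N < s (i.val + 1) y ∧ s (i.val + 1) y < ((c : ℝ) + 1) / N := by
      rintro c ⟨i, j, hij, hi, hj⟩
      rcases lt_or_gt_of_ne hij with h | h
      · exact ⟨i, hi.2.1, (hsmono y (Nat.succ_le_of_lt h)).trans_lt hj.2.2⟩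
      · exact ⟨j, hj.2.1, (hsmono y (Nat.succ_le_of_lt h)).trans_lt hi.2.2⟩
    have : Nonempty (Fin m) := by
      obtain ⟨i, -⟩ := Set.mem_iUnion.1 (hW ▸ Set.mem_univ y : y ∈ ⋃ i, W i)
      exact ⟨i⟩
    choose! g hg using hkey
    refine (Set.ncard_le_ncard_of_injOn g (t := Set.univ) (fun _ _ => Set.mem_univ _) ?_
      (Set.toFinite _)).trans (by simp [Set.ncard_univ])
    intro c hc c' hc' hcc
    have hN : (0 : ℝ) < N := by exact_mod_cast c.pos
    have h1 := hg c hc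
    have h2 := hg c' hc'
    rw [hcc] at h1
    have h3 : (c : ℝ) < c' + 1 := (div_lt_div_iff_of_pos_right hN).1 (h1.1.trans h2.2)
    have h4 : (c' : ℝ) < c + 1 := (div_lt_div_iff_of_pos_right hN).1 (h2.1.trans h1.2)
    have h5 : (c : ℕ) < c' + 1 := by exact_mod_cast h3
    have h6 : (c' : ℕ) < c + 1 := by exact_mod_cast h4
    exact Fin.ext (by omega)

/-! ### Maps to a cube that are adapted to a shrinking -/

/-- In a bump covering some function equals 1 at each point. This makes the map ε-fine, and off the
overlaps it removes one of the at most n + 1 nonzero coordinates from the count. -/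
theorem exists_cube_map {A : Type u} [MetricSpace A] [CompactSpace A] {B : Type v}
    [TopologicalSpace B] {f : A → B} (hf : Continuous f) {m n : ℕ} {ε : ℝ}
    {W W' : Fin m → Set B} {ι : Fin m → Type u} [∀ i, Finite (ι i)] {U : ∀ i, ι i → Set A}
    (hUo : ∀ i j, IsOpen (U i j)) (hUW : ∀ i, f ⁻¹' W i ⊆ ⋃ j, U i j)
    (hUε : ∀ i j, ∀ a ∈ U i j, ∀ b ∈ U i j, dist a b ≤ ε)
    (hUn : ∀ i x, {j | x ∈ U i j}.ncard ≤ n + 1)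
    (hWo : ∀ i, IsOpen (W' i)) (hWW : ∀ i, W' i ⊆ W i) (hW : ⋃ i, W' i = Set.univ) :
    ∃ φ : (Σ i, ι i) → A → ℝ, (∀ q, Continuous (φ q)) ∧ (∀ q x, φ q x ∈ Set.Icc (0 : ℝ) 1) ∧
      (∀ x x', (∀ q, φ q x = φ q x') → dist x x' ≤ ε) ∧
      ∀ x, (¬ ∃ i j, i ≠ j ∧ f x ∈ W' i ∧ f x ∈ W' j) →
        {q | φ q x ∈ Set.Ioo (0 : ℝ) 1}.ncard ≤ n := by
  obtain ⟨φ, hφ⟩ := BumpCovering.exists_isSubordinate_of_locallyFinite isClosed_univ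
    (fun q : Σ i, ι i => U q.1 q.2 ∩ f ⁻¹' W' q.1)
    (fun q => (hUo _ _).inter ((hWo _).preimage hf)) (locallyFinite_of_finite _) (by
      intro x _
      obtain ⟨i, hi⟩ := Set.mem_iUnion.1 (hW ▸ Set.mem_univ (f x) : f x ∈ ⋃ i, W' i)
      obtain ⟨j, hj⟩ := Set.mem_iUnion.1 (hUW i (hWW i hi : x ∈ f ⁻¹' W i))
      exact Set.mem_iUnion.2 ⟨⟨i, j⟩, hj, hi⟩)
  have hpos : ∀ q x, φ q x ≠ 0 → x ∈ U q.1 q.2 ∩ f ⁻¹' W' q.1 := fun q x h =>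
    hφ q (subset_tsupport _ (Function.mem_support.2 h))
  have hone : ∀ x, ∃ q, φ q x = 1 := fun x => ⟨_, φ.ind_apply x (Set.mem_univ x)⟩
  refine ⟨fun q x => φ q x, fun q => (φ q).continuous, fun q x => ⟨φ.nonneg q x, φ.le_one q x⟩,
    fun x x' h => ?_, fun x hx => ?_⟩
  · obtain ⟨q, hq⟩ := hone x
    have hq' : φ q x' = 1 := (h q).symm.trans hq
    exact hUε q.1 q.2 x (hpos q x (by simp [hq])).1 x' (hpos q x' (by simp [hq'])).1
  · obtain ⟨q₀, hq₀⟩ := hone x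
    have hq₀m := hpos q₀ x (by simp [hq₀])
    have hsub : {q | φ q x ∈ Set.Ioo (0 : ℝ) 1} ⊆
        Sigma.mk q₀.1 '' ({j | x ∈ U q₀.1 j} \ {q₀.2}) := by
      rintro ⟨i, j⟩ hq
      have hm := hpos _ _ (ne_of_gt hq.1)
      have hi : i = q₀.1 := by
        by_contra hne
        exact hx ⟨i, q₀.1, hne, hm.2, hq₀m.2⟩
      subst hi
      refine ⟨j, ⟨hm.1, ?_⟩, rfl⟩
      rintro rfl
      exact absurd hq₀ (ne_of_lt hq.2)
    refine (Set.ncard_le_ncard hsub (Set.toFinite _)).trans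
      ((Set.ncard_image_le (Set.toFinite _)).trans ?_)
    rw [Set.ncard_sdiff_singleton_of_mem (show q₀.2 ∈ {j | x ∈ U q₀.1 j} from hq₀m.1)]
    exact Nat.sub_le_of_le_add (hUn _ x)

/-- On the fibre powers of `f`, `ε`-fine maps to skeleta of cubes whose dimension exceeds `n` times
the number of factors by a bounded amount only. -/
theorem exists_fibre_power_maps {A : Type u} [MetricSpace A] [CompactSpace A] {B : Type v}
    [TopologicalSpace B] [CompactSpace B] [T2Space B] {f : A → B} (hf : Continuous f) {n : ℕ}
    (hn : ∀ y, CoveringDimLE (f ⁻¹' {y}) n) {ε : ℝ} (hε : 0 < ε) :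
    ∃ (C : ℕ) (Q : Type u) (_ : Fintype Q), ∀ (S : Type) [Fintype S], ∃ φ : S → Q → A → ℝ,
      (∀ a q, Continuous (φ a q)) ∧ (∀ a q x, φ a q x ∈ Set.Icc (0 : ℝ) 1) ∧
      (∀ a x x', (∀ q, φ a q x = φ a q x') → dist x x' ≤ ε) ∧
      ∀ (x : S → A) (y : B), (∀ a, f (x a) = y) →
        {r : S × Q | φ r.1 r.2 (x r.1) ∈ Set.Ioo (0 : ℝ) 1}.ncard ≤ n * Fintype.card S + C := by
  classical
  choose W hWo hyW ι hι U hUo hUW hUε hUn using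
    fun y => exists_cover_near_fibre hf y (hn y) hε
  obtain ⟨t, ht⟩ := (isCompact_univ (X := B)).elim_finite_subcover W hWo
    fun y _ => Set.mem_iUnion.2 ⟨y, hyW y⟩
  let e := t.equivFin.symm
  have hfin : ∀ i, Finite (ι (e i)) := fun i => hι _
  let Q : Type u := Σ i, ι (e i)
  let hQ : Fintype Q := Fintype.ofFinite Q
  -- At most `t.card` factors are in an overlap, each with at most |Q| fractional coordinates.
  refine ⟨t.card * Fintype.card Q, Q, hQ, fun S _ => ?_⟩
  obtain ⟨W', hWo', hWW', hWc', hWm'⟩ := exists_nearly_disjoint_shrinkings (fun i => W (e i))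
    (fun i => hWo _) (Set.eq_univ_of_forall fun y => by
      obtain ⟨z, hz, hyz⟩ := Set.mem_iUnion₂.1 (ht (Set.mem_univ y))
      exact Set.mem_iUnion.2 ⟨e.symm ⟨z, hz⟩, by simpa using hyz⟩) (Fintype.card S)
  choose φ hφc hφ01 hφε hφn using fun c : Fin (Fintype.card S) =>
    exists_cube_map hf (fun i => hUo (e i)) (fun i => hUW (e i)) (fun i => hUε (e i))
      (fun i => hUn (e i)) (hWo' c) (hWW' c) (hWc' c)
  let g := Fintype.equivFin S
  refine ⟨fun a => φ (g a), fun a => hφc _, fun a => hφ01 _, fun a => hφε _, fun x y hxy => ?_⟩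
  set bad : Finset S := Finset.univ.filter fun a => ∃ i j, i ≠ j ∧ y ∈ W' (g a) i ∧ y ∈ W' (g a) j
    with hbad
  have hbadcard : bad.card ≤ t.card := by
    refine le_trans (le_of_eq ?_) (hWm' y)
    rw [← Set.ncard_coe_finset, ← Set.ncard_image_of_injective _ g.injective]
    congr 1
    ext c
    simp only [Set.mem_image, Finset.mem_coe, hbad, Finset.mem_filter, Finset.mem_univ, true_and,
      Set.mem_ofPred_eq]
    exact ⟨by rintro ⟨a, h, rfl⟩; exact h, fun h => ⟨g.symm c, by simpa using h, by simp⟩⟩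
  have hcard : {r : S × Q | φ (g r.1) r.2 (x r.1) ∈ Set.Ioo (0 : ℝ) 1}.ncard =
      ∑ a, {q | φ (g a) q (x a) ∈ Set.Ioo (0 : ℝ) 1}.ncard := by
    rw [Set.ncard_eq_toFinset_card', Finset.card_eq_sum_card_fiberwise (f := Prod.fst)
      (t := Finset.univ) (fun _ _ => Finset.mem_coe.2 (Finset.mem_univ _))]
    refine Finset.sum_congr rfl fun a _ => ?_
    rw [← Set.ncard_coe_finset,
      ← Set.ncard_image_of_injective {q | φ (g a) q (x a) ∈ Set.Ioo (0 : ℝ) 1}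
        (Prod.mk_right_injective a)]
    congr 1
    ext ⟨b, q⟩
    simp only [Finset.coe_filter, Set.mem_toFinset, Set.mem_ofPred_eq, Set.mem_image, Prod.mk.injEq]
    exact ⟨by rintro ⟨h, rfl⟩; exact ⟨q, h, rfl, rfl⟩, by rintro ⟨_, h, rfl, rfl⟩; exact ⟨h, rfl⟩⟩
  rw [hcard]
  have hterm : ∀ a, {q | φ (g a) q (x a) ∈ Set.Ioo (0 : ℝ) 1}.ncard ≤
      n + if a ∈ bad then Fintype.card Q else 0 := by
    intro a
    split_ifs with h
    · refine le_add_left ?_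
      exact (Set.ncard_le_card _).trans_eq Nat.card_eq_fintype_card
    · refine hφn (g a) (x a) fun hex => h ?_
      rw [hxy a] at hex
      exact Finset.mem_filter.2 ⟨Finset.mem_univ a, hex⟩
  calc ∑ a, {q | φ (g a) q (x a) ∈ Set.Ioo (0 : ℝ) 1}.ncard
      ≤ ∑ a, (n + if a ∈ bad then Fintype.card Q else 0) := Finset.sum_le_sum fun a _ => hterm a
    _ = n * Fintype.card S + bad.card * Fintype.card Q := by
        rw [Finset.sum_add_distrib, Finset.sum_const, Finset.card_univ, smul_eq_mul, mul_comm,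
          ← Finset.sum_filter, Finset.sum_const, smul_eq_mul]
        simp
    _ ≤ n * Fintype.card S + t.card * Fintype.card Q := by gcongr

/-! ### Mean dimension of the subshift -/

/-- The tail of the weights is uniformly negligible, since distances in A are bounded by its
diameter. -/
theorem seqDist_le_of_forall_dist_le (k : ℕ) (A : Type u) [MetricSpace A] [CompactSpace A] {ε : ℝ}
    (hε : 0 < ε) : ∃ δ > 0, ∃ L : ℕ, ∀ x y : (Fin k → ℤ) → A,
      (∀ a, (∀ i, |a i| ≤ (L : ℤ)) → dist (x a) (y a) ≤ δ) → seqDist x y ≤ ε := by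
  set w : (Fin k → ℤ) → ℝ := fun a => (2 : ℝ) ^ (-∑ i, |a i|) with hw
  have hw0 : ∀ a, 0 ≤ w a := fun a => by positivity
  have hwS : Summable w := summable_w k
  set M : ℝ := Metric.diam (Set.univ : Set A) with hM
  have hM0 : 0 ≤ M := Metric.diam_nonneg
  have hS0 : 0 ≤ ∑' a, w a := tsum_nonneg hw0
  obtain ⟨s, hs⟩ : ∃ s : Finset (Fin k → ℤ), ∑' a : {a // a ∉ s}, w a < ε / 2 / (M + 1) :=
    ((tendsto_tsum_compl_atTop_zero w).eventually (gt_mem_nhds (by positivity))).exists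
  refine ⟨ε / 2 / (∑' a, w a + 1), by positivity,
    s.sup fun a => Finset.univ.sup fun i => (a i).natAbs, fun x y hxy => ?_⟩
  have hsum := summable_seqDist x y
  rw [seqDist, ← hsum.sum_add_tsum_subtype_compl s]
  have h1 : ∑ a ∈ s, w a * dist (x a) (y a) ≤ ε / 2 := by
    calc ∑ a ∈ s, w a * dist (x a) (y a)
        ≤ ∑ a ∈ s, w a * (ε / 2 / (∑' a, w a + 1)) := by
          refine Finset.sum_le_sum fun a ha => mul_le_mul_of_nonneg_left (hxy a fun i => ?_) (hw0 a)
          rw [Int.abs_eq_natAbs]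
          exact_mod_cast (Finset.le_sup (f := fun i => (a i).natAbs) (Finset.mem_univ i)).trans
            (Finset.le_sup (f := fun a : Fin k → ℤ => Finset.univ.sup fun i => (a i).natAbs) ha)
      _ = (∑ a ∈ s, w a) * (ε / 2 / (∑' a, w a + 1)) := by rw [Finset.sum_mul]
      _ ≤ (∑' a, w a + 1) * (ε / 2 / (∑' a, w a + 1)) := by
          gcongr
          linarith [hwS.sum_le_tsum s fun a _ => hw0 a]
      _ = ε / 2 := mul_div_cancel₀ _ (by positivity)
  have h2 : ∑' a : {a // a ∉ s}, w a * dist (x a) (y a) ≤ ε / 2 := by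
    have hws : Summable fun a : {a // a ∉ s} => w a := hwS.subtype _
    calc ∑' a : {a // a ∉ s}, w a * dist (x a) (y a)
        ≤ ∑' a : {a // a ∉ s}, w a * M := by
          refine (hsum.subtype _).tsum_le_tsum (fun a => ?_) (hws.mul_right M)
          exact mul_le_mul_of_nonneg_left
            (Metric.dist_le_diam_of_mem isCompact_univ.isBounded trivial trivial) (hw0 a)
      _ = (∑' a : {a // a ∉ s}, w a) * M := tsum_mul_right
      _ ≤ ε / 2 / (M + 1) * (M + 1) := by gcongr; linarith
      _ = ε / 2 := div_mul_cancel₀ _ (by positivity)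
  linarith

theorem exists_widim_le {k : ℕ} {A : Type u} [MetricSpace A] [CompactSpace A] {B : Type v}
    [TopologicalSpace B] [CompactSpace B] [T2Space B] {f : A → B} (hf : Continuous f) {n : ℕ}
    (hn : ∀ y, CoveringDimLE (f ⁻¹' {y}) n) {ε : ℝ} (hε : 0 < ε) :
    ∃ C L : ℕ, ∀ N : ℕ, widim (diagSubshift k f)
      (orbitDist (fun x y => seqDist (x : (Fin k → ℤ) → A) (y : (Fin k → ℤ) → A)) (cube k N)) ε ≤
        ((n * (N + L) ^ k + C : ℕ) : EReal) := by
  obtain ⟨δ, hδ, L, hL⟩ := seqDist_le_of_forall_dist_le k A hε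
  obtain ⟨C, Q, _, hQ⟩ := exists_fibre_power_maps hf hn hδ
  refine ⟨C, 2 * L + 1, fun N => ?_⟩
  -- This contains `cube k N` + [-L, L]^k, with one spare layer.
  let S : Finset (Fin k → ℤ) := Fintype.piFinset fun _ => Finset.Ico (-L : ℤ) (N + L + 1)
  have hS : Fintype.card S = (N + (2 * L + 1)) ^ k := by
    rw [Fintype.card_coe, Fintype.card_piFinset]
    simp only [Int.card_Ico, Finset.prod_const, Finset.card_univ, Fintype.card_fin]
    congr 1
    omega
  obtain ⟨φ, hφc, hφ01, hφδ, hφn⟩ := hQ S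
  refine widim_le_of_cube_map _ (fun z (r : S × Q) => φ r.1 r.2 (z.1 r.1)) (fun r => ?_)
    (fun z r => hφ01 _ _ _) (fun z => ?_) (fun z z' h => ?_)
  · exact (hφc _ _).comp ((continuous_apply _).comp continuous_subtype_val)
  · obtain ⟨y, hy⟩ := z.2
    rw [← hS]
    exact hφn (fun a => z.1 a) y fun a => (congrFun hy a).symm
  -- A supremum over an empty cube is 0, hence the need for 0 ≤ ε.
  · refine Real.iSup_le (fun γ => hL _ _ fun b hb => ?_) hε.le
    have hmem : (γ : Fin k → ℤ) + b ∈ S := Fintype.mem_piFinset.2 fun i => by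
      have h1 := Finset.mem_Ico.1 (Fintype.mem_piFinset.1 γ.2 i)
      have h2 := abs_le.1 (hb i)
      rw [Finset.mem_Ico, Pi.add_apply]
      omega
    exact hφδ ⟨_, hmem⟩ _ _ fun q => congrFun h (⟨_, hmem⟩, q)

/-- The boundary layer and the constant are of lower order than N^k; for the constant this needs `k
≠ 0`. -/
theorem tendsto_mul_add_pow_div (k n C L : ℕ) (hk : k ≠ 0) :
    Tendsto (fun N : ℕ => ((n * (N + L) ^ k + C : ℕ) : ℝ) / (N : ℝ) ^ k) atTop (𝓝 n) := by
  have h1 : Tendsto (fun N : ℕ => (n : ℝ) * (1 + (L : ℝ) / N) ^ k + C * ((1 : ℝ) / N) ^ k) atTop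
      (𝓝 (n * (1 + 0) ^ k + C * 0 ^ k)) :=
    (((tendsto_const_nhds.add (tendsto_const_div_atTop_nhds_zero_nat _)).pow k).const_mul _).add
      (((tendsto_const_div_atTop_nhds_zero_nat _).pow k).const_mul _)
  simp only [add_zero, one_pow, mul_one, zero_pow hk, mul_zero] at h1
  refine h1.congr' ?_
  filter_upwards [eventually_gt_atTop 0] with N hN
  have hN' : (N : ℝ) ≠ 0 := by exact_mod_cast hN.ne'
  rw [one_add_div hN', div_pow, div_pow, one_pow]
  push_cast
  field_simp

/-- The strict bound by n + 1 produces an admissible integer m ≤ n, and also admits empty fibres, of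
dimension -1. -/
theorem coveringDimLE_of_coveringDim_lt {X : Type u} [TopologicalSpace X] {n : ℕ}
    (h : coveringDim X < ((n + 1 : ℕ) : EReal)) : CoveringDimLE X n := by
  intro U hU hUo hUc
  rw [coveringDim] at h
  split_ifs at h with hX
  · exact ⟨∅, Set.finite_empty, by simp, Subsingleton.elim _ _, by simp, fun x => hX.elim x⟩
  · simp only [iInf_lt_iff] at h
    obtain ⟨m, hm, hmn⟩ := h
    have hmn' : m ≤ n := Nat.lt_succ_iff.1 (by exact_mod_cast hmn)
    obtain ⟨V, h1, h2, h3, h4, h5⟩ := hm U hU hUo hUc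
    exact ⟨V, h1, h2, h3, h4, fun x => (h5 x).trans (by gcongr)⟩

theorem coveringDim_nonneg {X : Type u} [TopologicalSpace X] [Nonempty X] :
    0 ≤ coveringDim X := by
  rw [coveringDim, if_neg (not_isEmpty_of_nonempty X)]
  exact le_iInf₂ fun m _ => by exact_mod_cast Nat.zero_le m

theorem meanDim_diagSubshift_le {k : ℕ} (hk : k ≠ 0) {A : Type u} [MetricSpace A] [CompactSpace A]
    {B : Type v} [TopologicalSpace B] [CompactSpace B] [T2Space B] {f : A → B} (hf : Continuous f)
    {n : ℕ} (hn : ∀ y, CoveringDimLE (f ⁻¹' {y}) n) :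
    meanDim k (diagSubshift k f)
      (fun x y => seqDist (x : (Fin k → ℤ) → A) (y : (Fin k → ℤ) → A)) ≤ (n : EReal) := by
  refine iSup₂_le fun ε hε => ?_
  obtain ⟨C, L, hCL⟩ := exists_widim_le (k := k) hf hn hε
  have hlim : Tendsto
      (fun N : ℕ => ((((n * (N + L) ^ k + C : ℕ) : ℝ) / (N : ℝ) ^ k : ℝ) : EReal)) atTop
      (𝓝 (n : EReal)) :=
    (EReal.tendsto_coe (a := (n : ℝ))).2 (tendsto_mul_add_pow_div k n C L hk)
  rw [← hlim.limsup_eq]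
  refine limsup_le_limsup (Eventually.of_forall fun N => ?_)
  have hN : (N : EReal) ^ k = (((N : ℝ) ^ k : ℝ) : EReal) := by
    rw [EReal.coe_pow]
    rfl
  simp only [EReal.coe_div, ← hN]
  exact EReal.div_le_div_right_of_nonneg (by rw [hN]; exact_mod_cast (by positivity)) (hCL N)

end MeanDim

theorem mainTheorem7 (k : ℕ) (hk : 1 ≤ k)
    (A : Type*) [MetricSpace A] [CompactSpace A] [Nonempty A]
    (B : Type*) [MetricSpace B] [CompactSpace B]
    (hA : MeanDim.coveringDim A < ⊤) (hB : MeanDim.coveringDim B < ⊤)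
    (f : A → B) (hf : Continuous f) :
    MeanDim.meanDim k (MeanDim.diagSubshift k f)
        (fun x y => MeanDim.seqDist (x : (Fin k → ℤ) → A) (y : (Fin k → ℤ) → A)) ≤
      ⨆ y : B, MeanDim.coveringDim (f ⁻¹' {y}) := by
  set s := ⨆ y : B, MeanDim.coveringDim (f ⁻¹' {y}) with hs
  have hle : ∀ y, MeanDim.coveringDim (f ⁻¹' {y}) ≤ s := fun y => le_iSup_iff.2 fun _ h => h y
  -- A point of A gives a nonempty fibre, so the bound by a natural number below loses nothing.
  have h0 : 0 ≤ s := by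
    obtain ⟨a⟩ := ‹Nonempty A›
    have : Nonempty (f ⁻¹' {f a}) := ⟨⟨a, rfl⟩⟩
    exact MeanDim.coveringDim_nonneg.trans (hle (f a))
  by_cases htop : s = ⊤
  · rw [htop]
    exact le_top
  have hreal : ((s.toReal : ℝ) : EReal) = s :=
    EReal.coe_toReal htop (ne_bot_of_le_ne_bot (by simp) h0)
  have hnn : 0 ≤ s.toReal := EReal.toReal_nonneg h0
  -- Every fibre has dimension less than ⌊s⌋ + 1, so n = ⌊s⌋ works.
  have hfloor : ((⌊s.toReal⌋₊ : ℕ) : EReal) ≤ s := by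
    rw [← hreal]
    exact EReal.coe_le_coe_iff.2 (Nat.floor_le hnn)
  refine (MeanDim.meanDim_diagSubshift_le (Nat.one_le_iff_ne_zero.1 hk) hf fun y => ?_).trans hfloor
  refine MeanDim.coveringDimLE_of_coveringDim_lt ((hle y).trans_lt ?_)
  rw [← hreal]
  refine EReal.coe_lt_coe_iff.2 ?_
  simpa using Nat.lt_floor_add_one s.toReal
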